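/- Let $X\subset\mathbb{P}^{n-1}$ be a non-singular complete intersection of codimension $2$ cut out by a cubic and a quadric hypersurface defined over $\mathbb{Q}$; that is, $X$ is given by $C_0=Q_0=0$ for a cubic form $C_0$ and a quadratic form $Q_0$ in $\mathbb{Q}[x_1,\dots,x_n]$ such that the ideal $(C_0,Q_0)$ has height $2$ and such that $\nabla C_0(x)$ and $\nabla Q_0(x)$ are linearly independent for every non-zero $x\in\overline{\mathbb{Q}}^{\,n}$ with $C_0(x)=Q_0(x)=0$. Then, after a suitable non-singular linear change of variables over $\mathbb{Q}$, $X$ is given by $C=Q=0$, where $C\in\mathbb{Z}[x_1,\dots,x_n]$ is a non-singular cubic form and $Q\in\mathbb{Z}[x_1,\dots,x_n]$ is a diagonal quadratic form of rank at least $n-1$. More precisely, there are $T\in\mathrm{GL}_n(\mathbb{Q})$ and such forms $C,Q$ for which the ideals $(C_0(Tx),Q_0(Tx))$ and $(C,Q)$ of $\mathbb{Q}[x_1,\dots,x_n]$ are equal. (Here $C$ is non-singular if $\nabla C(x)\neq 0$ for every non-zero $x\in\overline{\mathbb{Q}}^{\,n}$ with $C(x)=0$.) -/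

import Mathlib

noncomputable section

/-- The gradient of `F` at a geometric point `x`, i.e. at a point with coordinates in an algebraic
closure of `ℚ`. -/
def geomGradient {n : ℕ} (F : MvPolynomial (Fin n) ℚ) (x : Fin n → AlgebraicClosure ℚ) :
    Fin n → AlgebraicClosure ℚ :=
  fun i => MvPolynomial.aeval x (MvPolynomial.pderiv i F)

/-- The forms in the family `F` define a projective variety which satisfies the Jacobian criterion
for non-singularity: at each geometric point of projective space (represented by a nonzero
vector `x`) at which all the forms vanish, their gradients are linearly independent, that is, the
Jacobian matrix has rank equal to the number of forms. -/
def IsNonsingularSystem {n : ℕ} {ι : Type} (F : ι → MvPolynomial (Fin n) ℚ) : Prop :=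
  ∀ x : Fin n → AlgebraicClosure ℚ, x ≠ 0 → (∀ i, MvPolynomial.aeval x (F i) = 0) →
    LinearIndependent (AlgebraicClosure ℚ) (fun i => geomGradient (F i) x)

/-- The cubic form `C` and the quadratic form `Q` in `n` variables over `ℚ` cut out a non-singular
complete intersection in projective space of dimension `n - 1`: the homogeneous ideal `(C, Q)` has
codimension two, and the Jacobian matrix of `C, Q` has rank two at each geometric point of the
intersection. -/
structure IsNonsingularCubicQuadricIntersection {n : ℕ} (C Q : MvPolynomial (Fin n) ℚ) :
    Prop where
  cubic : C.IsHomogeneous 3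
  quadratic : Q.IsHomogeneous 2
  codim_two : (Ideal.span {C, Q}).height = 2
  nonsingular : IsNonsingularSystem ![C, Q]

/-- A form over `ℚ` is non-singular if the hypersurface which it defines is non-singular. -/
def IsNonsingularForm {n : ℕ} (C : MvPolynomial (Fin n) ℚ) : Prop :=
  IsNonsingularSystem ![C]

/-- The symmetric matrix `M` over `ℚ` of a quadratic form `Q`, with `Q(x) = xᵀ M x`; its entries
are one half of the second partial derivatives of `Q`. -/
def quadraticFormMatrix {n : ℕ} (Q : MvPolynomial (Fin n) ℚ) : Matrix (Fin n) (Fin n) ℚ :=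
  Matrix.of fun i j =>
    (1 / 2 : ℚ) * (MvPolynomial.pderiv i (MvPolynomial.pderiv j Q)).coeff 0

/-- The rank of a quadratic form over `ℚ`. -/
def quadraticFormRank {n : ℕ} (Q : MvPolynomial (Fin n) ℚ) : ℕ :=
  (quadraticFormMatrix Q).rank

/-- The ring homomorphism `F(x) ↦ F(T x)` given by a linear change of variables. -/
def linearSubst {n : ℕ} (T : Matrix.GeneralLinearGroup (Fin n) ℚ) :
    MvPolynomial (Fin n) ℚ →ₐ[ℚ] MvPolynomial (Fin n) ℚ :=
  MvPolynomial.aeval fun i =>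
    ∑ j, MvPolynomial.C ((T : Matrix (Fin n) (Fin n) ℚ) i j) * MvPolynomial.X j

/-- The polynomial over `ℚ` with the same coefficients as a given integral polynomial. -/
def intToRat {n : ℕ} (F : MvPolynomial (Fin n) ℤ) : MvPolynomial (Fin n) ℚ :=
  MvPolynomial.map (Int.castRingHom ℚ) F

/-- An integral quadratic form is diagonal if it is `d₁ x₁² + ⋯ + dₙ xₙ²` with integers `dᵢ`. -/
def IsDiagonalQuadratic {n : ℕ} (Q : MvPolynomial (Fin n) ℤ) : Prop :=
  ∃ d : Fin n → ℤ, Q = ∑ i, MvPolynomial.C (d i) * MvPolynomial.X i ^ 2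

end

/-! An orthogonal basis over `ℚ` diagonalizes the quadric. If two diagonal coefficients vanished,
the quadric would be singular along a whole line; the cubic has a geometric zero on that line, and
there the Jacobian rank drops (`card_ne_zero_of_isNonsingularSystem`).

To make the cubic non-singular, replace `F` by `F + L * Q` with `L` a linear form, which leaves the
ideal unchanged. Singular points with `Q = 0` are excluded by the Jacobian criterion for any `L`.
Those with `Q ≠ 0` are excluded for generic `L` by an elementary Bertini argument
(`exists_isNonsingularForm_add_mul`). Clearing denominators multiplies the generators by units. -/

open MvPolynomial Matrix

/-! ### Linear changes of variables and the Jacobian criterion -/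

section Gradient

variable {n : ℕ}

lemma aeval_linearSubst (T : GeneralLinearGroup (Fin n) ℚ) (F : MvPolynomial (Fin n) ℚ)
    (x : Fin n → AlgebraicClosure ℚ) :
    aeval x (linearSubst T F) =
      aeval ((T : Matrix (Fin n) (Fin n) ℚ).map (algebraMap ℚ (AlgebraicClosure ℚ)) *ᵥ x) F := by
  rw [linearSubst, ← AlgHom.comp_apply, comp_aeval]
  congr 2
  ext i
  simp [mulVec, dotProduct]

lemma pderiv_linearSubst (T : GeneralLinearGroup (Fin n) ℚ) (F : MvPolynomial (Fin n) ℚ)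
    (j : Fin n) :
    pderiv j (linearSubst T F) =
      ∑ i, C ((T : Matrix (Fin n) (Fin n) ℚ) i j) * linearSubst T (pderiv i F) := by
  induction F using MvPolynomial.induction_on with
  | C a => simp [linearSubst, MvPolynomial.algebraMap_eq]
  | add p q hp hq => simp [hp, hq, mul_add, Finset.sum_add_distrib]
  | mul_X p k hp =>
    have hX : pderiv j (linearSubst T (X k)) = C ((T : Matrix (Fin n) (Fin n) ℚ) k j) := by
      simp [linearSubst, Derivation.leibniz, pderiv_X, Pi.single_apply]
    rw [map_mul, Derivation.leibniz, hp, hX]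
    simp only [Derivation.leibniz, pderiv_X, map_add, smul_eq_mul, map_mul, mul_add,
      Finset.sum_add_distrib, Finset.mul_sum]
    congr 1
    · rw [Finset.sum_eq_single k]
      · simp [mul_comm]
      · intro b _ hb
        simp [hb]
      · simp
    · exact Finset.sum_congr rfl fun i _ => by ring

lemma geomGradient_linearSubst (T : GeneralLinearGroup (Fin n) ℚ) (F : MvPolynomial (Fin n) ℚ)
    (x : Fin n → AlgebraicClosure ℚ) :
    geomGradient (linearSubst T F) x =
      geomGradient F ((T : Matrix (Fin n) (Fin n) ℚ).map
        (algebraMap ℚ (AlgebraicClosure ℚ)) *ᵥ x) ᵥ*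
        (T : Matrix (Fin n) (Fin n) ℚ).map (algebraMap ℚ (AlgebraicClosure ℚ)) := by
  ext j
  simp [geomGradient, pderiv_linearSubst, aeval_linearSubst, vecMul, dotProduct, mul_comm]

lemma isUnit_map_generalLinearGroup (T : GeneralLinearGroup (Fin n) ℚ) :
    IsUnit ((T : Matrix (Fin n) (Fin n) ℚ).map (algebraMap ℚ (AlgebraicClosure ℚ))) :=
  T.isUnit.map (algebraMap ℚ (AlgebraicClosure ℚ)).mapMatrix

lemma IsNonsingularSystem.linearSubst {ι : Type} {F : ι → MvPolynomial (Fin n) ℚ}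
    (hF : IsNonsingularSystem F) (T : GeneralLinearGroup (Fin n) ℚ) :
    IsNonsingularSystem fun i => linearSubst T (F i) := by
  intro x hx h
  have hT := isUnit_map_generalLinearGroup T
  simp only [geomGradient_linearSubst, aeval_linearSubst] at h ⊢
  refine (hF _ ?_ h).map' (Matrix.vecMulLinear _)
    (LinearMap.ker_eq_bot.2 (Matrix.vecMul_injective_of_isUnit hT))
  intro h0
  exact hx (Matrix.mulVec_injective_of_isUnit hT (by simpa using h0))

lemma MvPolynomial.IsHomogeneous.linearSubst {F : MvPolynomial (Fin n) ℚ} {d : ℕ}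
    (hF : F.IsHomogeneous d) (T : GeneralLinearGroup (Fin n) ℚ) :
    (linearSubst T F).IsHomogeneous d := by
  have := hF.aeval (fun i => ∑ j, C ((T : Matrix (Fin n) (Fin n) ℚ) i j) * X j) (n := 1)
    fun i => IsHomogeneous.sum _ _ _ fun j _ => isHomogeneous_C_mul_X _ _
  simpa [_root_.linearSubst] using this

lemma isNonsingularForm_iff {F : MvPolynomial (Fin n) ℚ} :
    IsNonsingularForm F ↔ ∀ x : Fin n → AlgebraicClosure ℚ, x ≠ 0 → aeval x F = 0 →
      geomGradient F x ≠ 0 := by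
  refine forall_congr' fun x => forall_congr' fun _ => ?_
  simp only [Fin.forall_fin_one, Matrix.cons_val_zero]
  refine forall_congr' fun _ => ?_
  rw [linearIndependent_unique_iff]
  simp

lemma isNonsingularForm_C_mul {F : MvPolynomial (Fin n) ℚ} (hF : IsNonsingularForm F) {a : ℚ}
    (ha : a ≠ 0) : IsNonsingularForm (C a * F) := by
  rw [isNonsingularForm_iff] at hF ⊢
  intro x hx h h0
  refine hF x hx (by simpa [ha] using h) ?_
  ext i
  simpa [geomGradient, ha] using congrFun h0 i

end Gradient

/-! ### Diagonalization of rational quadratic forms -/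

section Diagonalization

variable {n : ℕ}

lemma pderiv_pderiv_comm {σ R : Type*} [CommRing R] (i j : σ) (F : MvPolynomial σ R) :
    pderiv i (pderiv j F) = pderiv j (pderiv i F) := by
  classical
  have h : ⁅pderiv (R := R) i, pderiv (R := R) j⁆ = 0 := by
    refine derivation_ext fun k => ?_
    simp [Derivation.commutator_apply, pderiv_X, Pi.single_apply, apply_ite]
  have := congrArg (fun D : Derivation R (MvPolynomial σ R) (MvPolynomial σ R) => D F) h
  rwa [Derivation.commutator_apply, Derivation.zero_apply, sub_eq_zero] at this

lemma quadraticFormMatrix_isSymm (Q : MvPolynomial (Fin n) ℚ) : (quadraticFormMatrix Q).IsSymm := by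
  ext i j
  simp only [quadraticFormMatrix, Matrix.transpose_apply, Matrix.of_apply]
  rw [pderiv_pderiv_comm]

/-- Euler's identity, applied to `Q` and then to its linear partial derivatives. -/
lemma eq_sum_quadraticFormMatrix {Q : MvPolynomial (Fin n) ℚ} (hQ : Q.IsHomogeneous 2) :
    Q = ∑ i, ∑ j, C (quadraticFormMatrix Q i j) * (X i * X j) := by
  have h1 := hQ.sum_X_mul_pderiv
  have h2 : ∀ j, pderiv j Q = ∑ i, X i * C (2 * quadraticFormMatrix Q i j) := by
    intro j
    have h := (hQ.pderiv (i := j)).sum_X_mul_pderiv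
    rw [Nat.add_one_sub_one, one_smul] at h
    rw [← h]
    refine Finset.sum_congr rfl fun i _ => ?_
    have := (hQ.pderiv (i := j)).pderiv (i := i)
    rw [← totalDegree_zero_iff_isHomogeneous, totalDegree_eq_zero_iff_eq_C] at this
    rw [this]
    simp [quadraticFormMatrix]
  have h3 : (2 : MvPolynomial (Fin n) ℚ) * Q =
      2 * ∑ i, ∑ j, C (quadraticFormMatrix Q i j) * (X i * X j) := by
    rw [two_mul, ← two_smul ℕ Q, ← h1, Finset.sum_comm, Finset.mul_sum]
    refine Finset.sum_congr rfl fun j _ => ?_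
    rw [h2, Finset.mul_sum, Finset.mul_sum]
    refine Finset.sum_congr rfl fun i _ => ?_
    simp only [C_mul, map_ofNat]
    ring
  exact mul_left_cancel₀ two_ne_zero h3

lemma exists_generalLinearGroup_transpose_mul_mul_eq_diagonal (M : Matrix (Fin n) (Fin n) ℚ)
    (hM : M.IsSymm) : ∃ (T : GeneralLinearGroup (Fin n) ℚ) (d : Fin n → ℚ),
      (T : Matrix (Fin n) (Fin n) ℚ)ᵀ * M * T = diagonal d := by
  have hB : LinearMap.IsSymm (Matrix.toBilin' M) := by
    constructor
    intro x y
    simp only [Matrix.toBilin'_apply', RingHom.id_apply]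
    rw [Matrix.dotProduct_mulVec, dotProduct_comm, ← Matrix.mulVec_transpose, hM.eq]
  obtain ⟨v, hv⟩ := LinearMap.BilinForm.exists_orthogonal_basis hB
  let w := v.reindex (finCongr (Module.finrank_fin_fun ℚ))
  let T := (Pi.basisFun ℚ (Fin n)).toMatrix w
  have : Invertible T := (Pi.basisFun ℚ (Fin n)).invertibleToMatrix w
  refine ⟨unitOfInvertible T, fun i => (Tᵀ * M * T) i i, ?_⟩
  ext i j
  simp only [val_unitOfInvertible, diagonal_apply]
  split_ifs with h
  · rw [h]
  · have hw : Matrix.toBilin' M (w i) (w j) = 0 := by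
      have := hv (i := (finCongr (Module.finrank_fin_fun ℚ)).symm i)
        (j := (finCongr (Module.finrank_fin_fun ℚ)).symm j) (by simpa using h)
      simpa [w, LinearMap.IsOrthoᵢ] using this
    rw [← hw, Matrix.toBilin'_apply', Matrix.mul_assoc]
    simp [Matrix.mul_apply, T, dotProduct, mulVec, Module.Basis.toMatrix_apply]

lemma exists_linearSubst_eq_diagonal {Q : MvPolynomial (Fin n) ℚ} (hQ : Q.IsHomogeneous 2) :
    ∃ (T : GeneralLinearGroup (Fin n) ℚ) (d : Fin n → ℚ),
      linearSubst T Q = ∑ i, C (d i) * X i ^ 2 := by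
  obtain ⟨T, d, h⟩ := exists_generalLinearGroup_transpose_mul_mul_eq_diagonal _
    (quadraticFormMatrix_isSymm Q)
  refine ⟨T, d, MvPolynomial.funext fun x => ?_⟩
  have h1 : eval x (linearSubst T Q) =
      ((T : Matrix (Fin n) (Fin n) ℚ) *ᵥ x) ⬝ᵥ
        (quadraticFormMatrix Q *ᵥ ((T : Matrix (Fin n) (Fin n) ℚ) *ᵥ x)) := by
    conv_lhs => rw [eq_sum_quadraticFormMatrix hQ]
    simp only [linearSubst, map_sum, map_mul, aeval_X, algHom_C, eval_X, eval_C,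
      MvPolynomial.algebraMap_eq]
    rw [dotProduct]
    refine Finset.sum_congr rfl fun i _ => ?_
    simp only [mulVec, dotProduct]
    rw [Finset.mul_sum]
    refine Finset.sum_congr rfl fun j _ => ?_
    ring
  have h2 : ((T : Matrix (Fin n) (Fin n) ℚ) *ᵥ x) ⬝ᵥ
        (quadraticFormMatrix Q *ᵥ ((T : Matrix (Fin n) (Fin n) ℚ) *ᵥ x)) =
        x ⬝ᵥ (diagonal d *ᵥ x) := by
    rw [← h, ← Matrix.mulVec_mulVec, ← Matrix.mulVec_mulVec, Matrix.dotProduct_mulVec x,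
      Matrix.vecMul_transpose]
  rw [h1, h2]
  simp only [dotProduct, mulVec_diagonal, map_sum, map_mul, eval_C, map_pow, eval_X]
  exact Finset.sum_congr rfl fun i _ => by ring

lemma quadraticFormRank_sum_C_mul_X_sq (d : Fin n → ℚ) :
    quadraticFormRank (∑ i, C (d i) * X i ^ 2) = Fintype.card {i // d i ≠ 0} := by
  have : quadraticFormMatrix (∑ i, C (d i) * X i ^ 2) = diagonal d := by
    ext i j
    have h : pderiv j (∑ i, C (d i) * X i ^ 2) = C (2 * d j) * X j := by
      rw [map_sum, Finset.sum_eq_single j]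
      · simp only [Derivation.leibniz, pderiv_X, Derivation.leibniz_pow, pderiv_C, Pi.single_eq_same,
          smul_eq_mul, nsmul_eq_mul, C_mul, map_ofNat]
        push_cast
        ring
      · intro b _ hb
        simp [Derivation.leibniz, Derivation.leibniz_pow, pderiv_X, hb]
      · simp
    rw [quadraticFormMatrix, Matrix.of_apply, h]
    by_cases hij : i = j
    · subst hij
      simp [Derivation.leibniz, pderiv_X]
    · simp [Derivation.leibniz, pderiv_X, hij, Ne.symm hij]
  rw [quadraticFormRank, this, Matrix.rank_diagonal]

end Diagonalization

/-! ### At most one diagonal coefficient vanishes -/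

section RankBound

variable {n : ℕ}

lemma MvPolynomial.IsHomogeneous.aeval_smul_apply {σ R A : Type*} [CommSemiring R]
    [CommSemiring A] [Algebra R A] {F : MvPolynomial σ R} {d : ℕ} (hF : F.IsHomogeneous d)
    (a : A) (x : σ → A) : MvPolynomial.aeval (a • x) F = a ^ d * MvPolynomial.aeval x F := by
  rw [aeval_def, aeval_def, eval₂_eq, eval₂_eq, Finset.mul_sum]
  refine Finset.sum_congr rfl fun m hm => ?_
  have hd : ∑ i ∈ m.support, m i = d := by
    rw [← hF (mem_support_iff.1 hm), Pi.one_def, ← Finsupp.degree_eq_weight_one]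
    rfl
  simp only [Pi.smul_apply, smul_eq_mul, mul_pow, Finset.prod_mul_distrib, Finset.prod_pow_eq_pow_sum,
    hd]
  ring

/-- Over an algebraically closed field, a cubic form vanishes somewhere on each projective line. -/
lemma exists_aeval_add_smul_eq_zero {K : Type*} [Field K] [IsAlgClosed K] [Algebra ℚ K]
    {F : MvPolynomial (Fin n) ℚ} (hF : F.IsHomogeneous 3) (u v : Fin n → K) :
    ∃ a b : K, (a ≠ 0 ∨ b ≠ 0) ∧ aeval (a • u + b • v) F = 0 := by
  by_contra! hne
  -- A univariate polynomial without roots over an algebraically closed field is constant.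
  have key : ∀ u v : Fin n → K, (∀ t : K, aeval (u + t • v) F ≠ 0) →
      ∃ c : K, ∀ t : K, aeval (u + t • v) F = c := by
    intro u v h
    let p : Polynomial K := aeval (fun i => Polynomial.C (u i) + Polynomial.X * Polynomial.C (v i)) F
    have hp : ∀ t, p.eval t = aeval (u + t • v) F := by
      intro t
      have : (Polynomial.aeval t : Polynomial K →ₐ[K] K).restrictScalars ℚ p
          = aeval (u + t • v) F := by
        rw [← AlgHom.comp_apply, comp_aeval]
        congr 2
        ext i
        simp only [map_add, map_mul, AlgHom.coe_restrictScalars',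
          Polynomial.aeval_C, Polynomial.aeval_X, Pi.add_apply, Pi.smul_apply, smul_eq_mul,
          Algebra.algebraMap_self, RingHom.id_apply]
      simpa [Polynomial.aeval_def] using this
    have hdeg : p.degree = 0 := by
      by_contra hd
      obtain ⟨t, ht⟩ := IsAlgClosed.exists_root p hd
      exact h t ((hp t).symm.trans ht)
    refine ⟨p.coeff 0, fun t => ?_⟩
    rw [← hp, Polynomial.eq_C_of_degree_eq_zero hdeg]
    simp
  obtain ⟨c, hc⟩ := key u v fun t => by simpa using hne 1 t (by simp)
  obtain ⟨c', hc'⟩ := key v u fun t => by simpa [add_comm] using hne t 1 (by simp)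
  have : CharZero K := algebraRat.charZero K
  have h1 := hc 1
  have h2 := hc 2
  have h3 := hc' 1
  have h4 := hc' 2⁻¹
  -- Compares the two affine charts of the line: `t = 1` gives `c' = c`, and cubic homogeneity at `u
  -- + 2v = 2(v + u/2)` gives `8c' = c`, so `c = 0`.
  have h5 : u + (2 : K) • v = (2 : K) • (v + (2⁻¹ : K) • u) := by
    rw [smul_add, smul_smul, mul_inv_cancel₀ two_ne_zero, one_smul, add_comm]
  rw [h5, hF.aeval_smul_apply, h4] at h2
  rw [add_comm] at h3
  simp only [one_smul] at h1 h3
  have hcc : c' = c := h3.symm.trans h1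
  have h6 : c = 0 := by
    rw [hcc] at h2
    linear_combination (1 / 7) * h2
  exact hne 1 1 (by simp) (by simpa [h6] using h1)

lemma card_ne_zero_of_isNonsingularSystem {F : MvPolynomial (Fin n) ℚ} (hF : F.IsHomogeneous 3)
    {d : Fin n → ℚ} (h : IsNonsingularSystem ![F, ∑ i, C (d i) * X i ^ 2]) :
    n - 1 ≤ Fintype.card {i // d i ≠ 0} := by
  by_contra! hlt
  have hc : 1 < Fintype.card {i // d i = 0} := by
    have := Fintype.card_subtype_compl fun i => d i = 0
    rw [Fintype.card_fin] at this
    change Fintype.card {i // d i ≠ 0} = _ at this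
    omega
  obtain ⟨⟨i, hi⟩, ⟨j, hj⟩, hij⟩ := Fintype.one_lt_card_iff.1 hc
  replace hij : i ≠ j := fun h => hij (Subtype.ext h)
  -- On the span of these two basis vectors both the diagonal form and its gradient vanish
  -- identically.
  obtain ⟨a, b, hab, h0⟩ := exists_aeval_add_smul_eq_zero (K := AlgebraicClosure ℚ) hF
    (Pi.single i 1) (Pi.single j 1)
  set x : Fin n → AlgebraicClosure ℚ := a • Pi.single i 1 + b • Pi.single j 1 with hx
  have hx0 : ∀ k, d k ≠ 0 → x k = 0 := by
    intro k hk
    have h1 : k ≠ i := by rintro rfl; exact hk hi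
    have h2 : k ≠ j := by rintro rfl; exact hk hj
    simp [hx, h1, h2]
  have hterm : ∀ k, algebraMap ℚ (AlgebraicClosure ℚ) (d k) * x k = 0 := by
    intro k
    by_cases hk : d k = 0
    · simp [hk]
    · simp [hx0 k hk]
  have hxne : x ≠ 0 := by
    intro hz
    have h1 := congrFun hz i
    have h2 := congrFun hz j
    simp [hx, hij, hij.symm] at h1 h2
    tauto
  refine (h x hxne ?_).ne_zero 1 ?_
  · rw [Fin.forall_fin_two]
    refine ⟨h0, ?_⟩
    simp only [Matrix.cons_val_one, Matrix.cons_val_zero, map_sum, map_mul, map_pow, aeval_X, aeval_C]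
    exact Finset.sum_eq_zero fun k _ => by rw [pow_two, ← mul_assoc, hterm, zero_mul]
  · ext k
    simp only [geomGradient, Matrix.cons_val_one, Matrix.cons_val_zero, map_sum, Pi.zero_apply]
    refine Finset.sum_eq_zero fun l _ => ?_
    by_cases hlk : l = k
    · subst hlk
      simp [Derivation.leibniz, Derivation.leibniz_pow, pderiv_X]
      simpa [or_comm] using hterm l
    · simp [Derivation.leibniz, Derivation.leibniz_pow, pderiv_X, hlk]

end RankBound

/-! ### A Bertini argument through algebraic dependence -/

section Bertini

variable {n : ℕ}

/-- Substitution sends the degree `e` component to degree `m * e`; since `m > 0`, distinct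
components cannot cancel. -/
lemma aeval_homogeneousComponent_eq_zero {σ τ R : Type*} [CommRing R] {G : τ → MvPolynomial σ R}
    {m : ℕ} (hm : 0 < m) (hG : ∀ i, (G i).IsHomogeneous m) {P : MvPolynomial τ R}
    (hP : aeval G P = 0) (d : ℕ) : aeval G (homogeneousComponent d P) = 0 := by
  have hh : ∀ e, (aeval G (homogeneousComponent e P)).IsHomogeneous (m * e) := fun e =>
    (homogeneousComponent_isHomogeneous e P).aeval G hG
  by_cases hd : d ≤ P.totalDegree
  · have h := congrArg (homogeneousComponent (m * d)) hP
    rw [map_zero, ← sum_homogeneousComponent P, map_sum, map_sum,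
      Finset.sum_eq_single d] at h
    · rwa [homogeneousComponent_eq_self (hh d)] at h
    · intro e _ he
      rw [homogeneousComponent_of_mem (hh e), if_neg]
      exact fun h => he (Nat.eq_of_mul_eq_mul_left hm h).symm
    · intro h
      exact absurd (Finset.mem_range.2 (Nat.lt_succ_of_le hd)) h
  · rw [homogeneousComponent_eq_zero _ _ (not_le.1 hd), map_zero]

/-- More forms of the same positive degree than there are variables satisfy a homogeneous
algebraic relation. -/
lemma exists_homogeneous_relation {σ τ k : Type} [Field k] [Fintype σ] [Fintype τ]
    (hcard : Fintype.card σ < Fintype.card τ) {G : τ → MvPolynomial σ k} {m : ℕ} (hm : 0 < m)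
    (hG : ∀ i, (G i).IsHomogeneous m) :
    ∃ (d : ℕ) (P : MvPolynomial τ k), P ≠ 0 ∧ P.IsHomogeneous d ∧ aeval G P = 0 := by
  have hdep : ¬ AlgebraicIndependent k G := by
    intro h
    have := h.cardinalMk_le_trdeg
    rw [MvPolynomial.trdeg_of_isDomain] at this
    simp only [Cardinal.mk_fintype, Cardinal.lift_natCast, Nat.cast_le] at this
    omega
  rw [algebraicIndependent_iff] at hdep
  push Not at hdep
  obtain ⟨P, hP, hne⟩ := hdep
  obtain ⟨d, hd⟩ : ∃ d, homogeneousComponent d P ≠ 0 := by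
    by_contra! h
    exact hne (by rw [← sum_homogeneousComponent P]; simp [h])
  exact ⟨d, _, hd, homogeneousComponent_isHomogeneous d P,
    aeval_homogeneousComponent_eq_zero hm hG hP d⟩

lemma exists_aeval_ne_zero_with_none_eq_one {σ k : Type*} [Field k] [Infinite k]
    {P : MvPolynomial (Option σ) k} (hP : P ≠ 0) {d : ℕ} (hd : P.IsHomogeneous d) :
    ∃ l : σ → k, eval (fun o => o.elim 1 l) P ≠ 0 := by
  -- The factor `X none` forces a nonzero `none` coordinate, which homogeneity then rescales to `1`.
  have : X none * P ≠ 0 := mul_ne_zero (X_ne_zero _) hP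
  obtain ⟨y, hy⟩ : ∃ y, eval y (X none * P) ≠ 0 := by
    by_contra! h
    exact this (MvPolynomial.funext fun y => by simpa using h y)
  rw [map_mul, eval_X] at hy
  refine ⟨fun i => (y none)⁻¹ * y (some i), fun h => right_ne_zero_of_mul hy ?_⟩
  have hy' : y = y none • fun o : Option σ => o.elim 1 fun i => (y none)⁻¹ * y (some i) := by
    ext o
    cases o <;> simp [left_ne_zero_of_mul hy]
  have := hd.aeval_smul_apply (y none) fun o : Option σ => o.elim 1 fun i => (y none)⁻¹ * y (some i)
  rw [← hy'] at this
  rw [← MvPolynomial.aeval_eq_eval] at h ⊢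
  change aeval y P = 0
  rw [this]
  exact mul_eq_zero_of_right _ h

lemma exists_isNonsingularForm_add_mul {F Q : MvPolynomial (Fin n) ℚ} (hF : F.IsHomogeneous 3)
    (hQ : Q.IsHomogeneous 2) (h : IsNonsingularSystem ![F, Q]) :
    ∃ L : MvPolynomial (Fin n) ℚ, L.IsHomogeneous 1 ∧ IsNonsingularForm (F + L * Q) := by
  -- Up to sign, the last `n` forms divided by `Q ^ 2` are the partial derivatives of `F / Q`. A
  -- singular point of `F + L * Q` with `Q ≠ 0` thus has `∇(F / Q) = -l`, where `l` is the
  -- coefficient vector of `L`. The `n + 1` quartics in `n` variables satisfy a relation `P`, so any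
  -- `l` with `P(1, l) ≠ 0` is avoided.
  let G : Option (Fin n) → MvPolynomial (Fin n) ℚ := fun o =>
    o.elim (Q ^ 2) fun i => F * pderiv i Q - Q * pderiv i F
  have hG : ∀ o, (G o).IsHomogeneous 4 := by
    rintro (_ | i)
    · exact hQ.pow 2
    · exact (hF.mul hQ.pderiv).sub (hQ.mul hF.pderiv)
  obtain ⟨d, P, hP, hd, hPG⟩ := exists_homogeneous_relation (by simp) (by norm_num) hG
  obtain ⟨l, hl⟩ := exists_aeval_ne_zero_with_none_eq_one hP hd
  refine ⟨∑ i, C (l i) * X i, IsHomogeneous.sum _ _ _ fun j _ => isHomogeneous_C_mul_X _ _, ?_⟩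
  set L : MvPolynomial (Fin n) ℚ := ∑ i, C (l i) * X i with hL
  have hdL : ∀ i, pderiv i L = C (l i) := by
    intro i
    simp [hL, Derivation.leibniz, pderiv_X, Pi.single_apply]
  rw [isNonsingularForm_iff]
  intro x hx h0 hgrad
  have hgrad' : ∀ i, aeval x (pderiv i F) + (aeval x L * aeval x (pderiv i Q) +
      aeval x Q * algebraMap ℚ (AlgebraicClosure ℚ) (l i)) = 0 := by
    intro i
    simpa [geomGradient, Derivation.leibniz, hdL] using congrFun hgrad i
  rw [map_add, map_mul] at h0
  by_cases hq : aeval x Q = 0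
  -- Here `∇F + L(x) ∇Q = 0` is a nontrivial relation at a point of the intersection.
  · have hf : aeval x F = 0 := by simpa [hq] using h0
    have hind := h x hx (by simp [Fin.forall_fin_two, hq, hf])
    rw [Fintype.linearIndependent_iff] at hind
    have := hind ![1, aeval x L] (by
      ext i
      simpa [Fin.sum_univ_two, geomGradient, hq] using hgrad' i) 0
    simp at this
  · have hGx : (fun o => aeval x (G o)) = (aeval x Q) ^ 2 •
        fun o : Option (Fin n) => algebraMap ℚ (AlgebraicClosure ℚ) (o.elim 1 l) := by
      ext o
      cases o with
      | none => simp [G]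
      | some i =>
        simp only [G, Option.elim_some, map_sub, map_mul, Pi.smul_apply, smul_eq_mul]
        linear_combination aeval x (pderiv i Q) * h0 - aeval x Q * hgrad' i
    have h1 : aeval (fun o => aeval x (G o)) P = 0 := by
      rw [← comp_aeval, AlgHom.comp_apply, hPG, map_zero]
    rw [hGx, hd.aeval_smul_apply, mul_eq_zero] at h1
    have h2 := h1.resolve_left (pow_ne_zero _ (pow_ne_zero _ hq))
    change aeval (algebraMap ℚ (AlgebraicClosure ℚ) ∘ fun o : Option (Fin n) => o.elim 1 l) P = 0
      at h2
    rw [aeval_algebraMap_apply, aeval_eq_eval] at h2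
    exact hl (by simpa using h2)

end Bertini

/-! ### Clearing denominators without changing the ideal -/

section Integrality

variable {n : ℕ}

lemma exists_intToRat_eq_C_mul (F : MvPolynomial (Fin n) ℚ) :
    ∃ (a : ℚ) (G : MvPolynomial (Fin n) ℤ), a ≠ 0 ∧ intToRat G = C a * F := by
  suffices h : ∃ (m : ℤ) (G : MvPolynomial (Fin n) ℤ), m ≠ 0 ∧ intToRat G = C (m : ℚ) * F by
    obtain ⟨m, G, hm, hG⟩ := h
    exact ⟨m, G, by exact_mod_cast hm, hG⟩
  induction F using MvPolynomial.induction_on with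
  | C a =>
    refine ⟨a.den, C a.num, by simp, ?_⟩
    rw [intToRat, map_C, ← C_mul]
    congr 1
    simp [Rat.den_mul_eq_num]
  | add p q hp hq =>
    obtain ⟨m, G, hm, hG⟩ := hp
    obtain ⟨m', G', hm', hG'⟩ := hq
    refine ⟨m * m', C m' * G + C m * G', mul_ne_zero hm hm', ?_⟩
    rw [intToRat] at hG hG' ⊢
    rw [map_add, map_mul, map_mul, map_C, map_C, hG, hG', Int.cast_mul, C_mul, eq_intCast, eq_intCast]
    ring
  | mul_X p i hp =>
    obtain ⟨m, G, hm, hG⟩ := hp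
    refine ⟨m, G * X i, hm, ?_⟩
    rw [intToRat] at hG ⊢
    rw [map_mul, hG, map_X, mul_assoc]

lemma exists_int_eq_mul (d : Fin n → ℚ) :
    ∃ (b : ℚ) (D : Fin n → ℤ), b ≠ 0 ∧ ∀ i, (D i : ℚ) = b * d i := by
  obtain ⟨b, hb⟩ := IsLocalization.exist_integer_multiples_of_finite (nonZeroDivisors ℤ) d
  choose D hD using hb
  refine ⟨((b : ℤ) : ℚ), D, by exact_mod_cast nonZeroDivisors.coe_ne_zero b, fun i => ?_⟩
  simpa using hD i

lemma span_pair_C_mul_add_mul {R : Type*} [CommRing R] {F Q L u v : R} (hu : IsUnit u)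
    (hv : IsUnit v) : Ideal.span {u * (F + L * Q), v * Q} = Ideal.span {F, Q} := by
  rw [Ideal.span_insert, Ideal.span_singleton_mul_left_unit hu, Ideal.span_singleton_mul_left_unit hv,
    ← Ideal.span_insert, Ideal.span_pair_add_mul_right]

end Integrality

theorem corollary3p2 (n : ℕ) (C₀ Q₀ : MvPolynomial (Fin n) ℚ)
    (hX : IsNonsingularCubicQuadricIntersection C₀ Q₀) :
    ∃ (T : Matrix.GeneralLinearGroup (Fin n) ℚ) (C Q : MvPolynomial (Fin n) ℤ),
      C.IsHomogeneous 3 ∧ IsNonsingularForm (intToRat C) ∧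
      Q.IsHomogeneous 2 ∧ IsDiagonalQuadratic Q ∧ n - 1 ≤ quadraticFormRank (intToRat Q) ∧
      Ideal.map (linearSubst T) (Ideal.span {C₀, Q₀}) =
        Ideal.span {intToRat C, intToRat Q} := by
  obtain ⟨T, d, hT⟩ := exists_linearSubst_eq_diagonal hX.quadratic
  have hns : IsNonsingularSystem ![linearSubst T C₀, linearSubst T Q₀] := by
    convert hX.nonsingular.linearSubst T using 1
    ext i : 1
    fin_cases i <;> rfl
  have hC := hX.cubic.linearSubst T
  obtain ⟨L, hL, hCL⟩ := exists_isNonsingularForm_add_mul hC (hX.quadratic.linearSubst T) hns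
  obtain ⟨a, G, ha, hG⟩ := exists_intToRat_eq_C_mul (linearSubst T C₀ + L * linearSubst T Q₀)
  obtain ⟨b, D, hb, hD⟩ := exists_int_eq_mul d
  have hQ : intToRat (∑ i, C (D i) * X i ^ 2) = C b * linearSubst T Q₀ := by
    rw [hT, Finset.mul_sum, intToRat, map_sum]
    refine Finset.sum_congr rfl fun i _ => ?_
    rw [map_mul, map_C, map_pow, map_X, eq_intCast, hD, C_mul, mul_assoc]
  refine ⟨T, G, ∑ i, C (D i) * X i ^ 2, ?_, ?_, ?_, ⟨D, rfl⟩, ?_, ?_⟩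
  · refine IsHomogeneous.of_map (f := Int.castRingHom ℚ) Int.cast_injective ?_
    change (intToRat G).IsHomogeneous 3
    rw [hG]
    exact (hC.add ((hL.mul (hX.quadratic.linearSubst T)))).C_mul a
  · rw [hG]
    exact isNonsingularForm_C_mul hCL ha
  · exact IsHomogeneous.sum _ _ _ fun i _ => isHomogeneous_C_mul_X_pow _ _ _
  · have hQ' : intToRat (∑ i, C (D i) * X i ^ 2) = ∑ i, C (D i : ℚ) * X i ^ 2 := by
      simp [intToRat]
    rw [hQ', quadraticFormRank_sum_C_mul_X_sq]
    rw [hT] at hns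
    simpa [hD, hb] using card_ne_zero_of_isNonsingularSystem hC hns
  · rw [Ideal.map_span, Set.image_pair, hG, hQ, span_pair_C_mul_add_mul (ha.isUnit.map C)
      (hb.isUnit.map C)]
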